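/- Let $S$ be a finite set of points in $\mathbb{R}^3$. The diameter graph on $S$ is the graph with vertex set $S$ in which two distinct points $x, y \in S$ are joined by an edge exactly when their Euclidean distance $\|x-y\|$ equals the diameter $D = \max_{a,b\in S}\|a-b\|$ of $S$. Then any two cycles of odd length in the diameter graph on $S$ have a vertex in common. -/

import Mathlib

/-- The diameter graph on a finite set `S` of points in `ℝ^d`: the vertices are the points of `S`,
and two distinct points are joined when their Euclidean distance is the diameter of `S`. -/
def diameterGraph {d : ℕ} (S : Finset (EuclideanSpace ℝ (Fin d))) : SimpleGraph S where
  Adj x y := x ≠ y ∧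
    dist (x : EuclideanSpace ℝ (Fin d)) (y : EuclideanSpace ℝ (Fin d)) =
      Metric.diam (S : Set (EuclideanSpace ℝ (Fin d)))
  symm := ⟨fun x y h => ⟨h.1.symm, by rw [dist_comm]; exact h.2⟩⟩
  loopless := ⟨fun _ h => h.1 rfl⟩

/-! For a closed walk `X` of odd length take the edge vectors with alternating signs. Odd period
makes this sequence end at the negative of its start, so with its negative it closes up to a
centrally symmetric spherical curve. Two such curves must cross up to sign
(`exists_segment_memDoubleCone`): the total angle that one turns around an axis `x` is odd in `x`,
continuous away from the curve, and congruent to `π` modulo `2π`, so it cannot change sign along the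
other curve. Consecutive signed edges are, up to a common sign, the directions from the middle
vertex to its two neighbours. A crossing thus gives a nonzero common vector of the cones at two
vertices `x ≠ y`, up to sign. With equal signs the hyperplane orthogonal to `y - x` separates the
cones (`cone_ne_cone_of_dist_le`); with opposite signs the diameter bound forces a vertex common to
both walks (`cone_ne_neg_cone_of_dist_le`). -/

open scoped RealInnerProductSpace

/-! ### Angles seen along an axis -/

/-- The determinant of three vectors of `ℝ³`. -/
def det3 (x a b : EuclideanSpace ℝ (Fin 3)) : ℝ :=
  x 0 * (a 1 * b 2 - a 2 * b 1) + x 1 * (a 2 * b 0 - a 0 * b 2) + x 2 * (a 0 * b 1 - a 1 * b 0)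

/-- The complex number whose argument is the angle from `a` to `b` seen along the axis `x`. -/
noncomputable def axialRatio (x a b : EuclideanSpace ℝ (Fin 3)) : ℂ :=
  ⟨‖x‖ ^ 2 * ⟪a, b⟫ - ⟪x, a⟫ * ⟪x, b⟫, ‖x‖ * det3 x a b⟩

theorem inner_eq_coords (a b : EuclideanSpace ℝ (Fin 3)) :
    ⟪a, b⟫ = a 0 * b 0 + a 1 * b 1 + a 2 * b 2 := by
  simp [PiLp.inner_apply, Fin.sum_univ_three, mul_comm]

theorem norm_sq_eq_coords (a : EuclideanSpace ℝ (Fin 3)) :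
    ‖a‖ ^ 2 = a 0 ^ 2 + a 1 ^ 2 + a 2 ^ 2 := by
  rw [← real_inner_self_eq_norm_sq, inner_eq_coords]; ring

/-- In the plane orthogonal to `x`, identified with `ℂ`, the ratio is `‖x‖ ^ 2` times `conj a' * b'`
for the projections `a'`, `b'`. Hence angles add along a polygon. -/
theorem axialRatio_mul (x a b c : EuclideanSpace ℝ (Fin 3)) :
    axialRatio x a b * axialRatio x b c = axialRatio x b b * axialRatio x a c := by
  apply Complex.ext
  · simp only [axialRatio, Complex.mul_re]
    have h1 : ‖x‖ * det3 x a b * (‖x‖ * det3 x b c) = ‖x‖ ^ 2 * (det3 x a b * det3 x b c) := by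
      ring
    have h2 : ‖x‖ * det3 x b b * (‖x‖ * det3 x a c) = ‖x‖ ^ 2 * (det3 x b b * det3 x a c) := by
      ring
    rw [h1, h2]
    simp only [norm_sq_eq_coords, inner_eq_coords, det3]
    ring
  · simp only [axialRatio, Complex.mul_im]
    have h : (‖x‖ ^ 2 * ⟪a, b⟫ - ⟪x, a⟫ * ⟪x, b⟫) * det3 x b c +
        det3 x a b * (‖x‖ ^ 2 * ⟪b, c⟫ - ⟪x, b⟫ * ⟪x, c⟫) =
        (‖x‖ ^ 2 * ⟪b, b⟫ - ⟪x, b⟫ * ⟪x, b⟫) * det3 x a c +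
        det3 x b b * (‖x‖ ^ 2 * ⟪a, c⟫ - ⟪x, a⟫ * ⟪x, c⟫) := by
      simp only [norm_sq_eq_coords, inner_eq_coords, det3]
      ring
    linear_combination ‖x‖ * h

theorem axialRatio_neg_left (x a b : EuclideanSpace ℝ (Fin 3)) :
    axialRatio (-x) a b = (starRingEnd ℂ) (axialRatio x a b) := by
  apply Complex.ext
  · simp [axialRatio]
  · simp [axialRatio, det3]
    ring

theorem axialRatio_neg_right (x a b : EuclideanSpace ℝ (Fin 3)) :
    axialRatio x a (-b) = -axialRatio x a b := by
  apply Complex.ext <;> (simp [axialRatio, det3]; ring)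

theorem axialRatio_self (x a : EuclideanSpace ℝ (Fin 3)) :
    axialRatio x a a = ((‖x‖ ^ 2 * ‖a‖ ^ 2 - ⟪x, a⟫ ^ 2 : ℝ) : ℂ) := by
  apply Complex.ext
  · rw [Complex.ofReal_re, axialRatio, real_inner_self_eq_norm_sq]
    ring
  · rw [Complex.ofReal_im, axialRatio, det3]
    ring

theorem gram_nonneg (x a : EuclideanSpace ℝ (Fin 3)) : 0 ≤ ‖x‖ ^ 2 * ‖a‖ ^ 2 - ⟪x, a⟫ ^ 2 := by
  have := abs_real_inner_le_norm x a
  nlinarith [abs_nonneg ⟪x, a⟫, sq_abs ⟪x, a⟫, norm_nonneg x, norm_nonneg a]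

theorem norm_sq_smul_eq_of_gram_nonpos {x a : EuclideanSpace ℝ (Fin 3)}
    (h : ‖x‖ ^ 2 * ‖a‖ ^ 2 - ⟪x, a⟫ ^ 2 ≤ 0) : ‖a‖ ^ 2 • x = ⟪x, a⟫ • a := by
  rw [← sub_eq_zero, ← norm_eq_zero, ← sq_eq_zero_iff]
  refine le_antisymm ?_ (sq_nonneg _)
  rw [← real_inner_self_eq_norm_sq]
  simp only [inner_sub_left, inner_sub_right, inner_smul_left, inner_smul_right,
    real_inner_self_eq_norm_sq, real_inner_comm x a]
  simp only [conj_trivial]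
  nlinarith [sq_nonneg ‖a‖]

theorem continuous_axialRatio (a b : EuclideanSpace ℝ (Fin 3)) :
    Continuous fun x => axialRatio x a b := by
  have h : (fun x => axialRatio x a b) = fun x : EuclideanSpace ℝ (Fin 3) =>
      ((‖x‖ ^ 2 * ⟪a, b⟫ - ⟪x, a⟫ * ⟪x, b⟫ : ℝ) : ℂ) + ((‖x‖ * det3 x a b : ℝ) : ℂ) * Complex.I := by
    funext x
    apply Complex.ext <;>
      simp only [axialRatio, Complex.add_re, Complex.add_im, Complex.re_ofReal_mul,
        Complex.im_ofReal_mul, Complex.ofReal_re, Complex.ofReal_im, Complex.I_re, Complex.I_im,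
        mul_zero, mul_one, add_zero, zero_add]
  rw [h]
  unfold det3
  fun_prop

/-! ### Double cones and the branch cut of the argument -/

/-- `x` lies on the union of the cone spanned by `a` and `b` and its opposite cone. -/
def MemDoubleCone (a b x : EuclideanSpace ℝ (Fin 3)) : Prop :=
  ∃ s t : ℝ, 0 ≤ s ∧ 0 ≤ t ∧ (x = s • a + t • b ∨ -x = s • a + t • b)

theorem MemDoubleCone.of_mul_nonneg {a b x : EuclideanSpace ℝ (Fin 3)} {s t : ℝ}
    (hst : 0 ≤ s * t) (hx : x = s • a + t • b) : MemDoubleCone a b x := by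
  rcases mul_nonneg_iff.1 hst with ⟨hs, ht⟩ | ⟨hs, ht⟩
  · exact ⟨s, t, hs, ht, Or.inl hx⟩
  · refine ⟨-s, -t, by linarith, by linarith, Or.inr ?_⟩
    rw [hx]; module

theorem MemDoubleCone.of_gram_nonpos {a x : EuclideanSpace ℝ (Fin 3)} (ha : a ≠ 0)
    (h : ‖x‖ ^ 2 * ‖a‖ ^ 2 - ⟪x, a⟫ ^ 2 ≤ 0) (b : EuclideanSpace ℝ (Fin 3)) :
    MemDoubleCone a b x := by
  have ha' : ‖a‖ ^ 2 ≠ 0 := by simpa using ha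
  refine MemDoubleCone.of_mul_nonneg (s := ⟪x, a⟫ / ‖a‖ ^ 2) (t := 0) (by simp) ?_
  rw [zero_smul, add_zero, div_eq_inv_mul, mul_smul, ← norm_sq_smul_eq_of_gram_nonpos h, smul_smul,
    inv_mul_cancel₀ ha', one_smul]

/-- Outside the double cone over `a` and `b`, the axial ratio avoids the closed negative ray. -/
theorem axialRatio_mem_slitPlane {x a b : EuclideanSpace ℝ (Fin 3)} (hab : 0 < ⟪a, b⟫)
    (hx : ¬ MemDoubleCone a b x) : axialRatio x a b ∈ Complex.slitPlane := by
  by_contra hns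
  rw [Complex.mem_slitPlane_iff] at hns
  push Not at hns
  obtain ⟨hre, him⟩ := hns
  simp only [axialRatio] at hre him
  have hx0 : ‖x‖ ≠ 0 := by
    intro h0
    exact hx ⟨0, 0, le_rfl, le_rfl, Or.inl (by simpa using norm_eq_zero.1 h0)⟩
  have hdet : det3 x a b = 0 := (mul_eq_zero.1 him).resolve_left hx0
  have ha0 : a ≠ 0 := by rintro rfl; simp at hab
  have ha : 0 < ‖a‖ ^ 2 := by positivity
  -- the squared norm of the cross product
  set N := ‖a‖ ^ 2 * ‖b‖ ^ 2 - ⟪a, b⟫ ^ 2 with hN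
  rcases (gram_nonneg a b).eq_or_lt with hz | hpos
  · have hb : ‖a‖ ^ 2 • b = ⟪b, a⟫ • a := by
      refine norm_sq_smul_eq_of_gram_nonpos ?_
      rw [real_inner_comm]
      linarith
    have hxb : ‖a‖ ^ 2 * ⟪x, b⟫ = ⟪a, b⟫ * ⟪x, a⟫ := by
      simpa [inner_smul_right, real_inner_comm a b] using congrArg (fun z => ⟪x, z⟫) hb
    refine hx (MemDoubleCone.of_gram_nonpos ha0 ?_ b)
    by_contra! hlt
    have hid : ⟪a, b⟫ * (‖x‖ ^ 2 * ‖a‖ ^ 2 - ⟪x, a⟫ ^ 2) =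
        ‖a‖ ^ 2 * (‖x‖ ^ 2 * ⟪a, b⟫ - ⟪x, a⟫ * ⟪x, b⟫) := by
      linear_combination ⟪x, a⟫ * hxb
    have := mul_pos hab hlt
    rw [hid] at this
    exact absurd (mul_nonpos_of_nonneg_of_nonpos ha.le hre) this.not_ge
  · set α := ⟪x, a⟫ * ‖b‖ ^ 2 - ⟪x, b⟫ * ⟪a, b⟫ with hα
    set β := ⟪x, b⟫ * ‖a‖ ^ 2 - ⟪x, a⟫ * ⟪a, b⟫ with hβ
    -- Cramer's rule: the defect of this combination is `det3 x a b` times the cross product of `a`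
    -- and `b`.
    have hcomb : N • x = α • a + β • b := by
      have e : ∀ i, N * x i - (α * a i + β * b i) = det3 x a b *
          (![a 1 * b 2 - a 2 * b 1, a 2 * b 0 - a 0 * b 2, a 0 * b 1 - a 1 * b 0] i) := by
        intro i
        rw [hN, hα, hβ]
        simp only [norm_sq_eq_coords, inner_eq_coords, det3]
        fin_cases i <;> simp <;> ring
      ext i
      have := e i
      rw [hdet, zero_mul] at this
      simpa using sub_eq_zero.1 this
    have hαβ : 0 ≤ α * β := by
      have hid : α * β = - (‖x‖ ^ 2 * ⟪a, b⟫ - ⟪x, a⟫ * ⟪x, b⟫) * N + ⟪a, b⟫ * det3 x a b ^ 2 := by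
        rw [hN, hα, hβ]
        simp only [norm_sq_eq_coords, inner_eq_coords, det3]
        ring
      rw [hid, hdet]
      nlinarith
    refine hx (MemDoubleCone.of_mul_nonneg (s := α / N) (t := β / N) ?_ ?_)
    · rw [div_mul_div_comm]; positivity
    · rw [div_eq_inv_mul, div_eq_inv_mul, mul_smul, mul_smul, ← smul_add, ← hcomb, smul_smul,
        inv_mul_cancel₀ hpos.ne', one_smul]

/-! ### Total turn and the crossing of antipodal paths -/

/-- The total angle swept by the polygon `e 0, …, e n` around the axis `x`. -/
noncomputable def axialTurn (e : ℕ → EuclideanSpace ℝ (Fin 3)) (n : ℕ)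
    (x : EuclideanSpace ℝ (Fin 3)) : ℝ :=
  ∑ j ∈ Finset.range n, (axialRatio x (e j) (e (j + 1))).arg

theorem axialRatio_self_ne_zero {x a b : EuclideanSpace ℝ (Fin 3)}
    (hx : ¬ MemDoubleCone a b x) (ha : a ≠ 0) : axialRatio x a a ≠ 0 := by
  rw [axialRatio_self, Complex.ofReal_ne_zero]
  exact fun h => hx (MemDoubleCone.of_gram_nonpos ha h.le b)

theorem coe_axialTurn {e : ℕ → EuclideanSpace ℝ (Fin 3)} (n : ℕ) {x : EuclideanSpace ℝ (Fin 3)}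
    (he : ∀ j, 0 < ⟪e j, e (j + 1)⟫) (hx : ∀ j ≤ n, ¬ MemDoubleCone (e j) (e (j + 1)) x) :
    (axialTurn e n x : Real.Angle) = (axialRatio x (e 0) (e n)).arg ∧
      axialRatio x (e 0) (e n) ≠ 0 := by
  have hne : ∀ j, e j ≠ 0 := fun j h => by simpa [h] using he j
  induction n with
  | zero =>
    have h0 := axialRatio_self_ne_zero (hx 0 le_rfl) (hne 0)
    refine ⟨?_, h0⟩
    rw [axialRatio_self] at h0 ⊢
    rw [Complex.arg_ofReal_of_nonneg (gram_nonneg x (e 0))]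
    simp [axialTurn]
  | succ k ih =>
    obtain ⟨h1, h2⟩ := ih fun j hj => hx j (by omega)
    have h3 := Complex.slitPlane_ne_zero (axialRatio_mem_slitPlane (he k) (hx k (by omega)))
    have hmul := axialRatio_mul x (e 0) (e k) (e (k + 1))
    have h4 := axialRatio_self_ne_zero (hx k (by omega)) (hne k)
    have h5 : axialRatio x (e 0) (e (k + 1)) ≠ 0 := by
      intro h
      rw [h, mul_zero] at hmul
      exact mul_ne_zero h2 h3 hmul
    refine ⟨?_, h5⟩
    have hsum : axialTurn e (k + 1) x =
        axialTurn e k x + (axialRatio x (e k) (e (k + 1))).arg := by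
      simp [axialTurn, Finset.sum_range_succ]
    rw [hsum, Real.Angle.coe_add, h1, ← Complex.arg_mul_coe_angle h2 h3, hmul]
    have hn : 0 < ‖x‖ ^ 2 * ‖e k‖ ^ 2 - ⟪x, e k⟫ ^ 2 := by
      rw [axialRatio_self, Complex.ofReal_ne_zero] at h4
      exact lt_of_le_of_ne (gram_nonneg x (e k)) h4.symm
    rw [axialRatio_self, Complex.arg_real_mul _ hn]

/-- Since `e n = -e 0`, the turn is `π` modulo `2π`. -/
theorem axialTurn_ne_zero {e : ℕ → EuclideanSpace ℝ (Fin 3)} {n : ℕ}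
    {x : EuclideanSpace ℝ (Fin 3)} (he : ∀ j, 0 < ⟪e j, e (j + 1)⟫) (hen : e n = -e 0)
    (hx : ∀ j, ¬ MemDoubleCone (e j) (e (j + 1)) x) : axialTurn e n x ≠ 0 := by
  intro h
  have h1 := (coe_axialTurn n he fun j _ => hx j).1
  have h0 := axialRatio_self_ne_zero (hx 0) (fun h => by simpa [h] using he 0)
  rw [h, hen, axialRatio_neg_right, Complex.arg_neg_coe_angle h0] at h1
  have h2 := (coe_axialTurn 0 he fun j _ => hx j).1
  rw [← h2] at h1
  simp only [axialTurn, Finset.range_zero, Finset.sum_empty, Real.Angle.coe_zero, zero_add] at h1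
  exact Real.Angle.pi_ne_zero h1.symm

theorem axialTurn_neg {e : ℕ → EuclideanSpace ℝ (Fin 3)} {n : ℕ}
    {x : EuclideanSpace ℝ (Fin 3)} (he : ∀ j, 0 < ⟪e j, e (j + 1)⟫)
    (hx : ∀ j, ¬ MemDoubleCone (e j) (e (j + 1)) x) : axialTurn e n (-x) = -axialTurn e n x := by
  unfold axialTurn
  rw [← Finset.sum_neg_distrib]
  refine Finset.sum_congr rfl fun j _ => ?_
  rw [axialRatio_neg_left, Complex.arg_conj, if_neg]
  exact Complex.slitPlane_arg_ne_pi (axialRatio_mem_slitPlane (he j) (hx j))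

theorem continuousOn_axialTurn {e : ℕ → EuclideanSpace ℝ (Fin 3)} (n : ℕ)
    (he : ∀ j, 0 < ⟪e j, e (j + 1)⟫) :
    ContinuousOn (axialTurn e n) {x | ∀ j, ¬ MemDoubleCone (e j) (e (j + 1)) x} := by
  refine continuousOn_finsetSum _ fun j _ x hx => ?_
  have h := Complex.continuousAt_arg (axialRatio_mem_slitPlane (he j) (hx j))
  exact (h.comp (f := fun x => axialRatio x (e j) (e (j + 1)))
    (continuous_axialRatio _ _).continuousAt).continuousWithinAt

/-- Two polygonal paths in `ℝ³`, each joining a point to its antipode, cannot avoid each other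
radially, up to sign. -/
theorem exists_segment_memDoubleCone {d e : ℕ → EuclideanSpace ℝ (Fin 3)} {m n : ℕ}
    (hd : d m = -d 0) (he : ∀ j, 0 < ⟪e j, e (j + 1)⟫) (hen : e n = -e 0) :
    ∃ i j, ∃ x ∈ segment ℝ (d i) (d (i + 1)), MemDoubleCone (e j) (e (j + 1)) x := by
  by_contra! hcon
  have hoff : ∀ i, segment ℝ (d i) (d (i + 1)) ⊆
      {x | ∀ j, ¬ MemDoubleCone (e j) (e (j + 1)) x} := fun i x hx j => hcon i j x hx
  have hd_off : ∀ i j, ¬ MemDoubleCone (e j) (e (j + 1)) (d i) :=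
    fun i => hoff i (left_mem_segment ℝ _ _)
  -- The turn is continuous and nonvanishing on each segment, so it keeps its sign there; by oddness
  -- it has opposite signs at `d 0` and `d m`.
  have hstep : ∀ i, 0 < axialTurn e n (d i) * axialTurn e n (d (i + 1)) := by
    intro i
    by_contra! hle
    have hcont := (continuousOn_axialTurn n he).mono (hoff i)
    have hpre := ((convex_segment (𝕜 := ℝ) (d i) (d (i + 1))).isPreconnected).image _ hcont
    have h0 : (0 : ℝ) ∈ axialTurn e n '' segment ℝ (d i) (d (i + 1)) := by
      have hl := Set.mem_image_of_mem (axialTurn e n) (left_mem_segment ℝ (d i) (d (i + 1)))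
      have hr := Set.mem_image_of_mem (axialTurn e n) (right_mem_segment ℝ (d i) (d (i + 1)))
      rcases mul_nonpos_iff.1 hle with ⟨h1, h2⟩ | ⟨h1, h2⟩
      · exact hpre.Icc_subset hr hl ⟨h2, h1⟩
      · exact hpre.Icc_subset hl hr ⟨h1, h2⟩
    obtain ⟨x, hx, hx0⟩ := h0
    exact axialTurn_ne_zero he hen (hoff i hx) hx0
  have hall : ∀ i, 0 < axialTurn e n (d 0) * axialTurn e n (d i) := by
    intro i
    induction i with
    | zero => exact mul_self_pos.2 (axialTurn_ne_zero he hen (hd_off 0))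
    | succ k ih =>
      by_contra! hle
      have := hstep k
      have h2 := mul_pos ih this
      nlinarith [mul_self_nonneg (axialTurn e n (d k))]
  have := hall m
  rw [hd, axialTurn_neg he (hd_off 0)] at this
  nlinarith [mul_self_nonneg (axialTurn e n (d 0))]

/-! ### Metric separation of cones of diameters -/

section Separation

variable {E : Type*} [NormedAddCommGroup E] [InnerProductSpace ℝ E] {D : ℝ}

theorem norm_sq_le_two_inner_of_dist_le {x a z : E} (ha : dist x a = D) (hz : dist z a ≤ D) :
    ‖z - x‖ ^ 2 ≤ 2 * ⟪z - x, a - x⟫ := by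
  have h1 : ‖(z - x) - (a - x)‖ ≤ D := by rwa [sub_sub_sub_cancel_right, ← dist_eq_norm]
  have h2 : ‖a - x‖ = D := by rw [← dist_eq_norm, dist_comm]; exact ha
  have h3 := norm_sub_sq_real (z - x) (a - x)
  nlinarith [norm_nonneg ((z - x) - (a - x))]

theorem eq_of_norm_eq_of_sq_le_inner {v w : E} (hv : ‖v‖ = D) (hw : ‖w‖ = D)
    (h : D ^ 2 ≤ ⟪v, w⟫) : v = w := by
  rw [← sub_eq_zero, ← norm_eq_zero, ← sq_eq_zero_iff]
  refine le_antisymm ?_ (sq_nonneg _)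
  rw [norm_sub_sq_real, hv, hw]
  linarith

/-- The cones of directions to points at distance `D` from two distinct points meet only at the
apex, when all distances are at most `D`. -/
theorem cone_ne_cone_of_dist_le {x y a b c d : E} (hxy : x ≠ y)
    (hxa : dist x a = D) (hxb : dist x b = D) (hyc : dist y c = D) (hyd : dist y d = D)
    (hya : dist y a ≤ D) (hyb : dist y b ≤ D) (hxc : dist x c ≤ D) (hxd : dist x d ≤ D)
    {s t s' t' : ℝ} (hs : 0 ≤ s) (ht : 0 ≤ t) (hst : 0 < s + t) (hs' : 0 ≤ s') (ht' : 0 ≤ t') :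
    s • (a - x) + t • (b - x) ≠ s' • (c - y) + t' • (d - y) := by
  intro h
  have h0 : 0 < ‖y - x‖ ^ 2 := by
    have := sub_ne_zero.2 hxy.symm
    positivity
  have h1 := norm_sq_le_two_inner_of_dist_le hxa hya
  have h2 := norm_sq_le_two_inner_of_dist_le hxb hyb
  have h3 := norm_sq_le_two_inner_of_dist_le hyc hxc
  have h4 := norm_sq_le_two_inner_of_dist_le hyd hxd
  rw [norm_sub_rev, ← neg_sub y x, inner_neg_left] at h3 h4
  -- The pairing with `y - x` is positive on the left cone and nonpositive on the right one.
  have h5 := congrArg (fun z => ⟪y - x, z⟫) h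
  simp only [inner_add_right, inner_smul_right] at h5
  have := mul_le_mul_of_nonneg_left h1 hs
  have := mul_le_mul_of_nonneg_left h2 ht
  have := mul_le_mul_of_nonneg_left h3 hs'
  have := mul_le_mul_of_nonneg_left h4 ht'
  have := mul_pos hst h0
  have := mul_nonneg hs' h0.le
  have := mul_nonneg ht' h0.le
  nlinarith

theorem one_le_add_of_norm_eq {a b v : E} (hD : 0 < D) (ha : ‖a‖ = D) (hb : ‖b‖ = D)
    (hv : ‖v‖ = D) {s t : ℝ} (hs : 0 ≤ s) (ht : 0 ≤ t) (h : v = s • a + t • b) : 1 ≤ s + t := by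
  have h1 := norm_add_le (s • a) (t • b)
  rw [← h, norm_smul, norm_smul, ha, hb, hv, Real.norm_of_nonneg hs, Real.norm_of_nonneg ht] at h1
  by_contra! hlt
  nlinarith

theorem eq_or_eq_of_add_eq_one {a b v : E} (ha : ‖a‖ = D) (hb : ‖b‖ = D)
    (hv : ‖v‖ = D) {s t : ℝ} (hs : 0 ≤ s) (ht : 0 ≤ t) (h : v = s • a + t • b)
    (hst : s + t = 1) : v = a ∨ v = b := by
  by_contra! hne
  have h1 : ⟪v, a⟫ < D ^ 2 := by
    by_contra! hle
    exact hne.1 (eq_of_norm_eq_of_sq_le_inner hv ha hle)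
  have h2 : ⟪v, b⟫ < D ^ 2 := by
    by_contra! hle
    exact hne.2 (eq_of_norm_eq_of_sq_le_inner hv hb hle)
  have h3 : ⟪v, v⟫ = s * ⟪v, a⟫ + t * ⟪v, b⟫ := by
    conv_lhs => rw [h, inner_add_right, inner_smul_right, inner_smul_right, ← h]
  rw [real_inner_self_eq_norm_sq, hv] at h3
  rcases hs.eq_or_lt with h0 | h0
  · have : t = 1 := by linarith
    subst this
    rw [← h0] at h3
    linarith
  · nlinarith [mul_lt_mul_of_pos_left h1 h0, mul_le_mul_of_nonneg_left h2.le ht]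

theorem cone_ne_neg_cone_of_norm_eq {x y a b c d v : E} (hD : 0 < D)
    (hya' : y ≠ a) (hyb' : y ≠ b) (hxc' : x ≠ c) (hxy : dist x y ≤ D)
    (hxa : dist x a = D) (hxb : dist x b = D) (hyc : dist y c = D) (hyd : dist y d = D)
    (hca : dist c a ≤ D) (hcb : dist c b ≤ D) (hda : dist d a ≤ D) (hdb : dist d b ≤ D)
    {s t s' t' : ℝ} (hs : 0 ≤ s) (ht : 0 ≤ t) (hs' : 0 ≤ s') (ht' : 0 ≤ t') (hv : ‖v‖ = D)
    (h : v = s • (a - x) + t • (b - x)) (h' : v = s' • (y - c) + t' • (y - d)) : False := by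
  have na : ‖a - x‖ = D := by rw [← dist_eq_norm, dist_comm]; exact hxa
  have nb : ‖b - x‖ = D := by rw [← dist_eq_norm, dist_comm]; exact hxb
  have nc : ‖y - c‖ = D := by rw [← dist_eq_norm]; exact hyc
  have nd : ‖y - d‖ = D := by rw [← dist_eq_norm]; exact hyd
  have hst := one_le_add_of_norm_eq hD na nb hv hs ht h
  have hst' := one_le_add_of_norm_eq hD nc nd hv hs' ht' h'
  have vv : ⟪v, v⟫ = D ^ 2 := by rw [real_inner_self_eq_norm_sq, hv]
  -- Equivalently, `x + v` is within `D` of `z`; this will be used for `c` and `d`.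
  have key : ∀ z, dist z a ≤ D → dist z b ≤ D → ‖z - x‖ ^ 2 ≤ 2 * ⟪z - x, v⟫ := by
    intro z hza hzb
    have h1 := norm_sq_le_two_inner_of_dist_le hxa hza
    have h2 := norm_sq_le_two_inner_of_dist_le hxb hzb
    rw [h, inner_add_right, inner_smul_right, inner_smul_right]
    nlinarith [mul_le_mul_of_nonneg_left h1 hs, mul_le_mul_of_nonneg_left h2 ht,
      mul_nonneg (sub_nonneg.2 hst) (sq_nonneg ‖z - x‖)]
  have key' : ∀ z, dist z a ≤ D → dist z b ≤ D → dist y z = D →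
      ‖y - x - v‖ ^ 2 ≤ 2 * ⟪y - x - v, y - z⟫ := by
    intro z hza hzb hyz
    have h1 := key z hza hzb
    have nz : ‖y - z‖ = D := by rw [← dist_eq_norm]; exact hyz
    have e1 : ‖z - x - v‖ ^ 2 = ‖z - x‖ ^ 2 - 2 * ⟪z - x, v⟫ + D ^ 2 := by
      rw [norm_sub_sq_real, hv]
    have e2 : z - x - v = (y - x - v) - (y - z) := by abel
    have e3 := norm_sub_sq_real (y - x - v) (y - z)
    rw [← e2, nz] at e3
    linarith
  have hc := key' c hca hcb hyc
  have hd := key' d hda hdb hyd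
  -- That is, `y - x` is within `D` of `2 • v`. As its norm is at most `D` and `‖2 • v‖ = 2 * D`, it
  -- must equal `v`.
  have hw : ‖y - x - v‖ ^ 2 ≤ 2 * ⟪y - x - v, v⟫ := by
    have : ⟪y - x - v, v⟫ = s' * ⟪y - x - v, y - c⟫ + t' * ⟪y - x - v, y - d⟫ := by
      conv_lhs => rw [h', inner_add_right, inner_smul_right, inner_smul_right, ← h']
    rw [this]
    nlinarith [mul_le_mul_of_nonneg_left hc hs', mul_le_mul_of_nonneg_left hd ht',
      mul_nonneg (sub_nonneg.2 hst') (sq_nonneg ‖y - x - v‖)]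
  have nw : ‖y - x‖ ≤ D := by rw [← dist_eq_norm, dist_comm]; exact hxy
  have hcs := real_inner_le_norm (y - x) v
  rw [norm_sub_sq_real, inner_sub_left (y - x) v v, vv, hv] at hw
  rw [hv] at hcs
  have nw' : ‖y - x‖ = D := by
    refine le_antisymm nw ?_
    by_contra! hlt
    nlinarith
  have hwv : y - x = v := by
    refine eq_of_norm_eq_of_sq_le_inner nw' hv ?_
    rw [nw'] at hw
    nlinarith
  -- With `v = y - x` the left side is `⟪x - c, z - y⟫`.
  have hfin : ∀ z, dist c z ≤ D → dist x z = D →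
      ⟪y - c, z - x⟫ - ⟪v, z - x⟫ - ⟪y - c, v⟫ + D ^ 2 ≤ 0 := by
    intro z hcz hxz
    have nz : ‖z - x‖ = D := by rw [← dist_eq_norm, dist_comm]; exact hxz
    have e1 : z - c = (y - c) + (z - x) - v := by rw [← hwv]; abel
    have e2 : ‖z - c‖ ≤ D := by rw [← dist_eq_norm, dist_comm]; exact hcz
    have e3 := norm_sub_sq_real ((y - c) + (z - x)) v
    rw [norm_add_sq_real, inner_add_left, ← e1, nc, nz, hv, real_inner_comm v (z - x)] at e3
    nlinarith [norm_nonneg (z - c)]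
  have ha := hfin a hca hxa
  have hb := hfin b hcb hxb
  have c1 : ⟪y - c, v⟫ = s * ⟪y - c, a - x⟫ + t * ⟪y - c, b - x⟫ := by
    conv_lhs => rw [h, inner_add_right, inner_smul_right, inner_smul_right]
  have c2 : D ^ 2 = s * ⟪v, a - x⟫ + t * ⟪v, b - x⟫ := by
    rw [← vv]
    conv_lhs => rw [h, inner_add_right, inner_smul_right, inner_smul_right, ← h]
  -- If `s + t = 1`, strict convexity of the ball makes `y` equal to `a` or `b`; otherwise averaging
  -- `ha` and `hb` forces `c = x`.
  rcases hst.eq_or_lt with h1 | h1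
  · rcases eq_or_eq_of_add_eq_one na nb hv hs ht h h1.symm with h2 | h2
    · exact hya' (sub_left_injective (hwv.trans h2))
    · exact hyb' (sub_left_injective (hwv.trans h2))
  · have hle : D ^ 2 ≤ ⟪y - c, v⟫ := by
      by_contra! hlt
      have hid : (s + t - 1) * (D ^ 2 - ⟪y - c, v⟫) =
          s * (⟪y - c, a - x⟫ - ⟪v, a - x⟫ - ⟪y - c, v⟫ + D ^ 2) +
          t * (⟪y - c, b - x⟫ - ⟪v, b - x⟫ - ⟪y - c, v⟫ + D ^ 2) := by
        linear_combination c1 - c2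
      have := mul_pos (sub_pos.2 h1) (sub_pos.2 hlt)
      have := mul_nonpos_of_nonneg_of_nonpos hs ha
      have := mul_nonpos_of_nonneg_of_nonpos ht hb
      linarith
    have := eq_of_norm_eq_of_sq_le_inner nc hv hle
    exact hxc' (sub_right_injective (hwv.trans this.symm))

/-- The cone of directions from `x` to points at distance `D` and the cone of directions into `y`
from points at distance `D` meet only at the apex, unless `x` or `y` is among these points. -/
theorem cone_ne_neg_cone_of_dist_le {x y a b c d : E} (hD : 0 < D)
    (hya' : y ≠ a) (hyb' : y ≠ b) (hxc' : x ≠ c) (hxy : dist x y ≤ D)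
    (hxa : dist x a = D) (hxb : dist x b = D) (hyc : dist y c = D) (hyd : dist y d = D)
    (hca : dist c a ≤ D) (hcb : dist c b ≤ D) (hda : dist d a ≤ D) (hdb : dist d b ≤ D)
    {s t s' t' : ℝ} (hs : 0 ≤ s) (ht : 0 ≤ t) (hs' : 0 ≤ s') (ht' : 0 ≤ t')
    (h0 : s • (a - x) + t • (b - x) ≠ 0) :
    s • (a - x) + t • (b - x) ≠ s' • (y - c) + t' • (y - d) := by
  intro h
  set V := s • (a - x) + t • (b - x) with hV
  set r := D / ‖V‖ with hr
  have hr0 : 0 < r := div_pos hD (norm_pos_iff.2 h0)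
  refine cone_ne_neg_cone_of_norm_eq (v := r • V) hD hya' hyb' hxc' hxy hxa hxb hyc hyd
    hca hcb hda hdb (mul_nonneg hr0.le hs) (mul_nonneg hr0.le ht) (mul_nonneg hr0.le hs')
    (mul_nonneg hr0.le ht') ?_ ?_ ?_
  · rw [norm_smul, Real.norm_of_nonneg hr0.le, hr, div_mul_cancel₀ _ (norm_ne_zero_iff.2 h0)]
  · rw [hV, smul_add, mul_smul, mul_smul]
  · rw [h, smul_add, mul_smul, mul_smul]

theorem inner_pos_of_dist_le {x a b : E} (hD : 0 < D) (hxa : dist x a = D) (hxb : dist x b = D)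
    (hab : dist a b ≤ D) : 0 < ⟪a - x, b - x⟫ := by
  have h := norm_sq_le_two_inner_of_dist_le hxb hab
  rw [← dist_eq_norm, dist_comm, hxa] at h
  nlinarith

end Separation

/-! ### Closed walks and alternating edges -/

theorem SimpleGraph.Walk.exists_periodic_sequence {V : Type*} {G : SimpleGraph V} {u : V}
    (p : G.Walk u u) (hp : 0 < p.length) :
    ∃ X : ℕ → V, (∀ i, G.Adj (X i) (X (i + 1))) ∧ (∀ i, X (i + p.length) = X i) ∧
      ∀ i, X i ∈ p.support := by
  refine ⟨fun i => p.getVert (i % p.length), fun i => ?_, fun i => ?_,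
    fun i => p.getVert_mem_support _⟩
  · have hlt := Nat.mod_lt i hp
    have hadj := p.adj_getVert_succ hlt
    have hsucc : p.getVert ((i + 1) % p.length) = p.getVert (i % p.length + 1) := by
      rw [← Nat.mod_add_mod]
      rcases Nat.lt_or_ge (i % p.length + 1) p.length with h | h
      · rw [Nat.mod_eq_of_lt h]
      · have h' : i % p.length + 1 = p.length := by omega
        rw [h', Nat.mod_self, p.getVert_zero, p.getVert_length]
    simpa only [hsucc] using hadj
  · simp only [Nat.add_mod_right]

section AlternatingEdge

variable {E : Type*} [AddCommGroup E] [Module ℝ E]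

/-- The edge vectors of a sequence of points, with alternating signs. -/
def alternatingEdge (X : ℕ → E) (i : ℕ) : E := (-1 : ℝ) ^ i • (X (i + 1) - X i)

theorem alternatingEdge_of_odd_period {X : ℕ → E} {m : ℕ} (hm : Odd m)
    (hX : ∀ i, X (i + m) = X i) : alternatingEdge X m = -alternatingEdge X 0 := by
  have h0 := hX 0
  have h1 := hX 1
  rw [zero_add] at h0
  rw [add_comm] at h1
  simp [alternatingEdge, hm.neg_one_pow, h0, h1]

theorem exists_sign_alternatingEdge (X : ℕ → E) (i : ℕ) :
    ∃ η : ℝ, (η = 1 ∨ η = -1) ∧ alternatingEdge X i = η • (X i - X (i + 1)) ∧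
      alternatingEdge X (i + 1) = η • (X (i + 2) - X (i + 1)) := by
  refine ⟨(-1) ^ (i + 1), neg_one_pow_eq_or ℝ _, ?_, rfl⟩
  rw [alternatingEdge, pow_succ]
  module

end AlternatingEdge

theorem mainTheorem4 (S : Finset (EuclideanSpace ℝ (Fin 3))) (u v : S)
    (p : (diameterGraph S).Walk u u) (q : (diameterGraph S).Walk v v)
    (hp : p.IsCycle) (hq : q.IsCycle) (hp_odd : Odd p.length) (hq_odd : Odd q.length) :
    ∃ w : S, w ∈ p.support ∧ w ∈ q.support := by
  by_contra! hdisj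
  obtain ⟨X', hXadj, hXper, hXmem⟩ := p.exists_periodic_sequence hp_odd.pos
  obtain ⟨Y', hYadj, hYper, hYmem⟩ := q.exists_periodic_sequence hq_odd.pos
  set D := Metric.diam (S : Set (EuclideanSpace ℝ (Fin 3))) with hD_def
  set X : ℕ → EuclideanSpace ℝ (Fin 3) := fun i => X' i with hX
  set Y : ℕ → EuclideanSpace ℝ (Fin 3) := fun i => Y' i with hY
  have hle : ∀ a b : S, dist (a : EuclideanSpace ℝ (Fin 3)) b ≤ D := fun a b =>
    Metric.dist_le_diam_of_mem S.finite_toSet.isBounded a.2 b.2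
  have hXX : ∀ i j, dist (X i) (X j) ≤ D := fun i j => hle _ _
  have hXY : ∀ i j, dist (X i) (Y j) ≤ D := fun i j => hle _ _
  have hYX : ∀ i j, dist (Y i) (X j) ≤ D := fun i j => hle _ _
  have hYY : ∀ i j, dist (Y i) (Y j) ≤ D := fun i j => hle _ _
  have hne : ∀ i j, X i ≠ Y j := fun i j h =>
    hdisj (X' i) (hXmem i) (Subtype.ext h ▸ hYmem j)
  have hX1 : ∀ i, dist (X i) (X (i + 1)) = D := fun i => (hXadj i).2
  have hX2 : ∀ i, dist (X (i + 1)) (X i) = D := fun i => by rw [dist_comm, hX1]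
  have hY1 : ∀ i, dist (Y i) (Y (i + 1)) = D := fun i => (hYadj i).2
  have hY2 : ∀ i, dist (Y (i + 1)) (Y i) = D := fun i => by rw [dist_comm, hY1]
  have hD : 0 < D := by
    rw [← hX1 0]
    exact dist_pos.2 fun h => (hXadj 0).1 (Subtype.ext h)
  have hinner : ∀ Z : ℕ → EuclideanSpace ℝ (Fin 3), (∀ i, dist (Z i) (Z (i + 1)) = D) →
      (∀ i j, dist (Z i) (Z j) ≤ D) →
      ∀ i, 0 < ⟪Z i - Z (i + 1), Z (i + 2) - Z (i + 1)⟫ := fun Z h1 h2 i =>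
    inner_pos_of_dist_le hD (by rw [dist_comm, h1]) (h1 (i + 1)) (h2 _ _)
  have he : ∀ j, 0 < ⟪alternatingEdge Y j, alternatingEdge Y (j + 1)⟫ := by
    intro j
    obtain ⟨θ, hθ, h1, h2⟩ := exists_sign_alternatingEdge Y j
    have := hinner Y hY1 hYY j
    rcases hθ with rfl | rfl <;> simpa [h1, h2, -neg_sub] using this
  obtain ⟨i, j, x, ⟨s, t, hs, ht, hst, hxs⟩, s', t', hs', ht', hx⟩ :=
    exists_segment_memDoubleCone
      (alternatingEdge_of_odd_period hp_odd (X := X) fun i => congrArg Subtype.val (hXper i)) he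
      (alternatingEdge_of_odd_period hq_odd (X := Y) fun i => congrArg Subtype.val (hYper i))
  obtain ⟨η, hη, h1, h2⟩ := exists_sign_alternatingEdge X i
  obtain ⟨θ, hθ, h3, h4⟩ := exists_sign_alternatingEdge Y j
  rw [h1, h2] at hxs
  rw [h3, h4, ← hxs] at hx
  -- The zero vector lies in every double cone, so a crossing at the origin has to be excluded; the
  -- acute angle between the two edges does this.
  have hpos : s • (X i - X (i + 1)) + t • (X (i + 2) - X (i + 1)) ≠ 0 := by
    intro h0
    have hin := hinner X hX1 hXX i
    have h5 := congrArg (fun z => ⟪X i - X (i + 1), z⟫) h0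
    have h6 := congrArg (fun z => ⟪z, X (i + 2) - X (i + 1)⟫) h0
    simp only [inner_add_right, inner_add_left, inner_smul_right, real_inner_smul_left,
      real_inner_self_eq_norm_sq, inner_zero_right, inner_zero_left] at h5 h6
    have h7 := mul_nonneg hs (sq_nonneg ‖X i - X (i + 1)‖)
    have h8 := mul_nonneg ht (sq_nonneg ‖X (i + 2) - X (i + 1)‖)
    nlinarith [mul_nonneg hs hin.le, mul_nonneg ht hin.le]
  have hplus := cone_ne_cone_of_dist_le (hne (i + 1) (j + 1)) (hX2 i) (hX1 (i + 1)) (hY2 j)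
    (hY1 (j + 1)) (hYX _ _) (hYX _ _) (hXY _ _) (hXY _ _) hs ht (by linarith) hs' ht'
  have hminus := cone_ne_neg_cone_of_dist_le hD (hne i (j + 1)).symm (hne (i + 2) (j + 1)).symm
    (hne (i + 1) j) (hXY _ _) (hX2 i) (hX1 (i + 1)) (hY2 j) (hY1 (j + 1))
    (hYX _ _) (hYX _ _) (hYX (j + 2) i) (hYX (j + 2) (i + 2)) hs ht hs' ht' hpos
  -- The signs `η`, `θ` and the one from the double cone matter only through their product.
  have hcases : s • (X i - X (i + 1)) + t • (X (i + 2) - X (i + 1)) =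
        s' • (Y j - Y (j + 1)) + t' • (Y (j + 2) - Y (j + 1)) ∨
      s • (X i - X (i + 1)) + t • (X (i + 2) - X (i + 1)) =
        s' • (Y (j + 1) - Y j) + t' • (Y (j + 1) - Y (j + 2)) := by
    rcases hη with rfl | rfl <;> rcases hθ with rfl | rfl <;> rcases hx with hx | hx
    · left; exact sub_eq_zero.1 (Eq.trans (by module) (sub_eq_zero.2 hx))
    · right; exact sub_eq_zero.1 (Eq.trans (by module) (sub_eq_zero.2 hx.symm))
    · right; exact sub_eq_zero.1 (Eq.trans (by module) (sub_eq_zero.2 hx))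
    · left; exact sub_eq_zero.1 (Eq.trans (by module) (sub_eq_zero.2 hx.symm))
    · right; exact sub_eq_zero.1 (Eq.trans (by module) (sub_eq_zero.2 hx.symm))
    · left; exact sub_eq_zero.1 (Eq.trans (by module) (sub_eq_zero.2 hx))
    · left; exact sub_eq_zero.1 (Eq.trans (by module) (sub_eq_zero.2 hx.symm))
    · right; exact sub_eq_zero.1 (Eq.trans (by module) (sub_eq_zero.2 hx))
  exact hcases.elim hplus hminus
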